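/- Let $n \ge 0$ and $k \ge 2$ be integers, let $\mathcal{N}_n = \mathbb{C}[x_1,\dots,x_n]/(x_1,\dots,x_n)^2$, and let $T^{(k)}_{\mathcal{N}_n} \in \mathcal{N}_n \otimes (\mathcal{N}_n^*)^{\otimes k}$ be the tensor of order $k+1$ corresponding to the multilinear map $\mathcal{N}_n^{\times k} \to \mathcal{N}_n$, $(a_1,\dots,a_k) \mapsto a_1 \cdots a_k$. For a tensor $T \in V_1 \otimes \cdots \otimes V_m$ (with $V_i$ finite-dimensional complex vector spaces) and for $S \in W_1 \otimes \cdots \otimes W_m$, say that $T$ *restricts* to $S$ if $S = (X_1 \otimes \cdots \otimes X_m)T$ for some linear maps $X_i : V_i \to W_i$, and that $T$ *degenerates* to $S$ if $S$ lies in the (Euclidean) closure of the set of all restrictions of $T$ in $W_1 \otimes \cdots \otimes W_m$. The *subrank* $\mathrm{Q}(T)$ (respectively the *border subrank* $\underline{\mathrm{Q}}(T)$) is the largest $q$ such that $T$ restricts (respectively degenerates) to the unit tensor $\sum_{i=1}^q e_i \otimes \cdots \otimes e_i \in (\mathbb{C}^q)^{\otimes m}$. The *geometric rank* $\mathrm{GR}(T)$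 with respect to the factor $V_p$ is the codimension of the variety of all $(\alpha_i)_{i \ne p} \in \prod_{i \neq p} V_i^*$ such that $T(\alpha_1,\dots,\alpha_m) = 0$ for all $\alpha_p \in V_p^*$. Then: - if $n \ge 1$, then $\mathrm{GR}(T^{(k)}_{\mathcal{N}_n}) = 2$, with respect to each of the $k+1$ tensor factors; - if $k = 2$ and $n \ge 2$, then $\mathrm{Q}(T^{(k)}_{\mathcal{N}_n}) = \underline{\mathrm{Q}}(T^{(k)}_{\mathcal{N}_n}) = 2$; - if $k \ge 3$, then $\mathrm{Q}(T^{(k)}_{\mathcal{N}_n}) = \underline{\mathrm{Q}}(T^{(k)}_{\mathcal{N}_n}) = 1$. -/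

import Mathlib

open scoped TensorProduct

namespace TensorRank

universe u v w

/-! ### Restriction, degeneration, subrank and border subrank -/

section Tensors

variable {ι : Type w} {V : ι → Type u} {W : ι → Type v}
  [∀ i, AddCommGroup (V i)] [∀ i, Module ℂ (V i)]
  [∀ i, AddCommGroup (W i)] [∀ i, Module ℂ (W i)]

/-- `T` restricts to `S` if `S = (⨂ X i) T` for some linear maps `X i : V i → W i`. -/
def Restricts (T : ⨂[ℂ] i, V i) (S : ⨂[ℂ] i, W i) : Prop :=
  ∃ X : ∀ i, V i →ₗ[ℂ] W i, PiTensorProduct.map X T = S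

/-- `T` degenerates to `S` if `S` lies in the closure of the set of restrictions of `T`.
The module topology of a finite-dimensional complex vector space is its Euclidean topology. -/
def Degenerates (T : ⨂[ℂ] i, V i) (S : ⨂[ℂ] i, W i) : Prop :=
  S ∈ @closure _ (moduleTopology ℂ (⨂[ℂ] i, W i)) {S' | Restricts T S'}

/-- The unit tensor `∑ e_i ⊗ ⋯ ⊗ e_i` (with `i` from `1` to `q`) in `ℂ^q ⊗ ⋯ ⊗ ℂ^q`,
with one tensor factor for each element of `ι`. -/
noncomputable def unitTensor (ι : Type w) (q : ℕ) : ⨂[ℂ] _ : ι, (Fin q → ℂ) :=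
  ∑ i : Fin q, ⨂ₜ[ℂ] _ : ι, (Pi.single i 1 : Fin q → ℂ)

/-- The subrank of `T` is `q`: this is the largest number such that `T` restricts to the
unit tensor of that size. -/
def IsSubrank (T : ⨂[ℂ] i, V i) (q : ℕ) : Prop :=
  IsGreatest {r : ℕ | Restricts T (unitTensor ι r)} q

/-- The border subrank of `T` is `q`: this is the largest number such that `T` degenerates to
the unit tensor of that size. -/
def IsBorderSubrank (T : ⨂[ℂ] i, V i) (q : ℕ) : Prop :=
  IsGreatest {r : ℕ | Degenerates T (unitTensor ι r)} q

end Tensors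

/-! ### Codimension and geometric rank -/

section Codim

variable {E : Type u} [AddCommGroup E] [Module ℂ E]

/-- The codimension of an algebraic set `Z` in a finite-dimensional complex vector space `E`:
the height of its vanishing ideal in the polynomial ring in the coordinates of `E` with respect
to a basis. By `codim_eq` the basis does not matter. -/
noncomputable def codim [Module.Finite ℂ E] (Z : Set E) : ℕ∞ :=
  (MvPolynomial.vanishingIdeal ℂ ((Module.finBasis ℂ E).equivFun '' Z)).height

/-- The linear change of coordinates, on polynomials. -/
noncomputable def changeCoord {σ τ : Type*} [Fintype σ] [Fintype τ]
    (b : Module.Basis σ ℂ E) (c : Module.Basis τ ℂ E) :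
    MvPolynomial σ ℂ →ₐ[ℂ] MvPolynomial τ ℂ :=
  MvPolynomial.aeval fun i => ∑ j, MvPolynomial.C (b.equivFun (c j) i) * MvPolynomial.X j

theorem aeval_changeCoord {σ τ : Type*} [Fintype σ] [Fintype τ]
    (b : Module.Basis σ ℂ E) (c : Module.Basis τ ℂ E) (v : E) (p : MvPolynomial σ ℂ) :
    MvPolynomial.aeval (c.equivFun v) (changeCoord b c p) =
      MvPolynomial.aeval (b.equivFun v) p := by
  have h : (MvPolynomial.aeval (c.equivFun v)).comp (changeCoord b c) =
      (MvPolynomial.aeval (b.equivFun v) : MvPolynomial σ ℂ →ₐ[ℂ] ℂ) := by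
    apply MvPolynomial.algHom_ext
    intro i
    have hv : b.equivFun v i = ∑ j, c.equivFun v j * b.equivFun (c j) i := by
      conv_lhs => rw [← c.sum_equivFun v]
      simp only [map_sum, map_smul, Finset.sum_apply, Pi.smul_apply, smul_eq_mul]
    simp only [AlgHom.comp_apply, changeCoord, MvPolynomial.aeval_X, hv, map_sum, map_mul,
      MvPolynomial.aeval_C, mul_comm]
    rfl
  exact DFunLike.congr_fun h p

theorem changeCoord_changeCoord {σ τ : Type*} [Fintype σ] [Fintype τ]
    (b : Module.Basis σ ℂ E) (c : Module.Basis τ ℂ E) (p : MvPolynomial σ ℂ) :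
    changeCoord c b (changeCoord b c p) = p := by
  apply MvPolynomial.funext
  intro x
  obtain ⟨v, rfl⟩ := b.equivFun.surjective x
  have h := (aeval_changeCoord c b v (changeCoord b c p)).trans (aeval_changeCoord b c v p)
  simpa [MvPolynomial.coe_aeval_eq_eval] using h

/-- The codimension can be computed in the coordinates of any basis. -/
theorem codim_eq [Module.Finite ℂ E] {σ : Type*} [Fintype σ] (b : Module.Basis σ ℂ E)
    (Z : Set E) :
    codim Z = (MvPolynomial.vanishingIdeal ℂ (b.equivFun '' Z)).height := by
  let c := Module.finBasis ℂ E
  let e : MvPolynomial σ ℂ ≃+* MvPolynomial (Fin (Module.finrank ℂ E)) ℂ :=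
    { (changeCoord b c).toRingHom with
      invFun := changeCoord c b
      left_inv := changeCoord_changeCoord b c
      right_inv := changeCoord_changeCoord c b }
  rw [codim, ← RingEquiv.height_comap e]
  congr 1
  ext p
  have he : e p = changeCoord b c p := rfl
  simp only [Ideal.mem_comap, MvPolynomial.mem_vanishingIdeal_iff, Set.forall_mem_image, he]
  exact forall₂_congr fun v _ => by rw [aeval_changeCoord b c v p]

end Codim

section GeometricRank

variable {ι : Type w} [Finite ι] {V : ι → Type u}
  [∀ i, AddCommGroup (V i)] [∀ i, Module ℂ (V i)]

/-- The variety of tuples `(α i)_{i ≠ i₀}` of linear forms such that `T(α, β) = 0` for every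
linear form `β` on the factor with index `i₀`. In the definition, `γ = (α, β)`. -/
def kernelVariety (T : ⨂[ℂ] i, V i) (i₀ : ι) :
    Set (∀ i : {i : ι // i ≠ i₀}, Module.Dual ℂ (V i)) :=
  {α | ∀ γ : ∀ i, Module.Dual ℂ (V i), (∀ i : {i : ι // i ≠ i₀}, γ i = α i) →
    PiTensorProduct.dualDistrib (⨂ₜ[ℂ] i, γ i) T = 0}

/-- The geometric rank of `T`, computed with respect to the factor with index `i₀`. -/
noncomputable def geometricRank [∀ i, Module.Finite ℂ (V i)] (T : ⨂[ℂ] i, V i) (i₀ : ι) : ℕ∞ :=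
  codim (kernelVariety T i₀)

end GeometricRank

/-! ### Structure tensors of algebras -/

section Structure

/-- The tensor factors `A, A*, …, A*` of the `k`-th structure tensor: the index `none` is
that of `A`, the indices `some j` are those of the `k` copies of `A*`. -/
def Factor (A : Type u) [AddCommGroup A] [Module ℂ A] (k : ℕ) : Option (Fin k) → Type u
  | none => A
  | some _ => Module.Dual ℂ A

variable (A : Type u)

instance [AddCommGroup A] [Module ℂ A] (k : ℕ) : ∀ i, AddCommGroup (Factor A k i)
  | none => inferInstanceAs (AddCommGroup A)
  | some _ => inferInstanceAs (AddCommGroup (Module.Dual ℂ A))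

instance [AddCommGroup A] [Module ℂ A] (k : ℕ) : ∀ i, Module ℂ (Factor A k i)
  | none => inferInstanceAs (Module ℂ A)
  | some _ => inferInstanceAs (Module ℂ (Module.Dual ℂ A))

instance [AddCommGroup A] [Module ℂ A] [Module.Finite ℂ A] (k : ℕ) :
    ∀ i, Module.Finite ℂ (Factor A k i)
  | none => inferInstanceAs (Module.Finite ℂ A)
  | some _ => inferInstanceAs (Module.Finite ℂ (Module.Dual ℂ A))

variable {A} in
/-- The family with entry `a` in `A` and entries `f j` in the copies of `A*`. -/
def factorMk [AddCommGroup A] [Module ℂ A] {k : ℕ} (a : A) (f : Fin k → Module.Dual ℂ A) :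
    ∀ i, Factor A k i
  | none => a
  | some j => f j

variable {A} in
/-- The family of linear forms on the factors with entry `α` in `A*` and entries `a j` in the
copies of `A** = A`. -/
def factorDualMk [AddCommGroup A] [Module ℂ A] {k : ℕ} (α : Module.Dual ℂ A) (a : Fin k → A) :
    ∀ i, Module.Dual ℂ (Factor A k i)
  | none => α
  | some j => Module.Dual.eval ℂ A (a j)

variable [Ring A] [Algebra ℂ A] [Module.Finite ℂ A] (k : ℕ)

/-- The `k`-th structure tensor in `A ⊗ A* ⊗ ⋯ ⊗ A*` of a finite-dimensional associative unital
algebra `A`: the tensor of the multilinear map `(a_1, …, a_k) ↦ a_1 ⋯ a_k`, written out in a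
basis. It does not depend on the basis, see `structureTensor_apply`. -/
noncomputable def structureTensor : ⨂[ℂ] i, Factor A k i :=
  ∑ s : Fin k → Fin (Module.finrank ℂ A),
    ⨂ₜ[ℂ] i, factorMk
      (MultilinearMap.mkPiAlgebraFin ℂ k A fun j => Module.finBasis ℂ A (s j))
      (fun j => (Module.finBasis ℂ A).coord (s j)) i

/-- As a multilinear form, the structure tensor is `(α, a_1, …, a_k) ↦ α(a_1 ⋯ a_k)`. -/
theorem structureTensor_apply (α : Module.Dual ℂ A) (a : Fin k → A) :
    PiTensorProduct.dualDistrib (⨂ₜ[ℂ] i, factorDualMk α a i) (structureTensor A k) =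
      α (List.ofFn a).prod := by
  classical
  have h : (List.ofFn a).prod = MultilinearMap.mkPiAlgebraFin ℂ k A
      (fun j => ∑ i, (Module.finBasis ℂ A).coord i (a j) • Module.finBasis ℂ A i) := by
    simp [Module.Basis.sum_repr]
  rw [h, MultilinearMap.map_sum, map_sum, structureTensor, map_sum]
  refine Finset.sum_congr rfl fun s _ => ?_
  rw [PiTensorProduct.dualDistrib_apply, Fintype.prod_option, MultilinearMap.map_smul_univ,
    map_smul, smul_eq_mul, mul_comm]
  rfl

end Structure

/-! ### Null algebras -/

/-- The null algebra `ℂ[x_1, …, x_n] / (x_1, …, x_n)^2`. -/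
abbrev NullAlgebra (n : ℕ) : Type :=
  MvPolynomial (Fin n) ℂ ⧸
    (Ideal.span (Set.range (MvPolynomial.X : Fin n → MvPolynomial (Fin n) ℂ))) ^ 2

instance (n : ℕ) : Module.Finite ℂ (NullAlgebra n) := by
  have h : Algebra.IsIntegral ℂ (NullAlgebra n) := by
    constructor
    intro y
    obtain ⟨p, rfl⟩ := Ideal.Quotient.mk_surjective y
    induction p using MvPolynomial.induction_on with
    | C a => exact isIntegral_algebraMap (R := ℂ) (A := NullAlgebra n) (x := a)
    | add p q hp hq => rw [map_add]; exact hp.add hq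
    | mul_X p i hp =>
      rw [map_mul]
      refine hp.mul (IsIntegral.of_pow (n := 2) two_pos ?_)
      rw [← map_pow, Ideal.Quotient.eq_zero_iff_mem.mpr
        (Ideal.pow_mem_pow (Ideal.subset_span (Set.mem_range_self i)) 2)]
      exact isIntegral_zero
  exact Algebra.IsIntegral.finite

end TensorRank

/-! In the basis 1, x_1, …, x_n the structure tensor is the explicit polynomial `nullForm`. Call the
coordinate at 1 in the `j`-th copy of the dual its unit coordinate. Every monomial contains all unit
coordinates but at most one, so the form vanishes when two of them do (`nullForm_eq_zero_of_two`).

Border subrank: a restriction to (ℂ^r)^{⊗(k+1)} yields vectors c_l, the images of the dual vector of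
1, such that the tensor vanishes on functionals killing c_l and c_m in two factors l ≠ m. Taking the
c_l on the unit sphere makes this a closed condition, by compactness. For the unit tensor it forces
any two chosen support indices of c_l and c_m to exhaust `Fin r`; hence r ≤ 2, and r ≤ 1 if k ≥ 3.
Explicit restrictions attain these bounds.

Geometric rank: the kernel variety contains a nonempty set cut out by two equations, so Krull's
height theorem bounds its codimension by 2. Conversely, a prime over its vanishing ideal contains a
coordinate and a polynomial that is not a multiple of it, so its height is at least 2. -/

namespace TensorRank

/-! ### The null algebra as a trivial square-zero extension -/

section NullAlgebra

variable (n : ℕ)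

/-- The map from the null algebra to the trivial square-zero extension of `ℂ` by `ℂ^n`. -/
noncomputable def nullToTrivSqZeroExt : NullAlgebra n →ₐ[ℂ] TrivSqZeroExt ℂ (Fin n → ℂ) :=
  Ideal.Quotient.liftₐ _
    (MvPolynomial.aeval fun i => TrivSqZeroExt.inr (Pi.single i (1 : ℂ))) <| by
    intro a ha
    rw [pow_two] at ha
    induction ha using Submodule.mul_induction_on' with
    | add x _ y _ hx hy => rw [map_add, hx, hy, add_zero]
    | mem_mul_mem x hx y hy =>
      have key : ∀ z ∈ Ideal.span (Set.range (MvPolynomial.X : Fin n → MvPolynomial (Fin n) ℂ)),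
          (MvPolynomial.aeval (fun i => TrivSqZeroExt.inr (Pi.single i (1 : ℂ))) z :
            TrivSqZeroExt ℂ (Fin n → ℂ)).fst = 0 := by
        intro z hz
        have hle : Ideal.span (Set.range (MvPolynomial.X : Fin n → MvPolynomial (Fin n) ℂ)) ≤
            RingHom.ker ((TrivSqZeroExt.fstHom ℂ ℂ (Fin n → ℂ)).comp
              (MvPolynomial.aeval fun i => TrivSqZeroExt.inr (Pi.single i (1 : ℂ)))) := by
          rw [Ideal.span_le]
          rintro _ ⟨i, rfl⟩
          simp [RingHom.mem_ker]
        exact hle hz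
      rw [map_mul]
      ext <;> simp [key x hx, key y hy]

@[simp]
theorem nullToTrivSqZeroExt_X (i : Fin n) :
    nullToTrivSqZeroExt n (Ideal.Quotient.mk _ (MvPolynomial.X i)) =
      TrivSqZeroExt.inr (Pi.single i 1) := by
  exact MvPolynomial.aeval_X _ i

theorem mk_X_mul_mk_X (i j : Fin n) :
    (Ideal.Quotient.mk _ (MvPolynomial.X i) * Ideal.Quotient.mk _ (MvPolynomial.X j) :
      NullAlgebra n) = 0 := by
  rw [← map_mul, Ideal.Quotient.eq_zero_iff_mem, pow_two]
  exact Ideal.mul_mem_mul (Ideal.subset_span ⟨i, rfl⟩) (Ideal.subset_span ⟨j, rfl⟩)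

/-- The inverse of `nullToTrivSqZeroExt`. -/
noncomputable def trivSqZeroExtToNull : TrivSqZeroExt ℂ (Fin n → ℂ) →ₐ[ℂ] NullAlgebra n :=
  TrivSqZeroExt.lift (Algebra.ofId ℂ (NullAlgebra n))
    (Fintype.linearCombination ℂ fun i => Ideal.Quotient.mk _ (MvPolynomial.X i))
    (by
      intro x y
      simp only [Fintype.linearCombination_apply, Finset.sum_mul_sum, smul_mul_smul_comm,
        mk_X_mul_mk_X, smul_zero, Finset.sum_const_zero])
    (by
      intro r x
      rw [map_smul, Algebra.smul_def]; rfl)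
    (by
      intro r x
      rw [op_smul_eq_smul, map_smul, Algebra.smul_def, mul_comm]; rfl)

/-- The null algebra is the trivial square-zero extension of `ℂ` by `ℂ^n`. -/
noncomputable def nullAlgEquiv : NullAlgebra n ≃ₐ[ℂ] TrivSqZeroExt ℂ (Fin n → ℂ) :=
  AlgEquiv.ofAlgHom (nullToTrivSqZeroExt n) (trivSqZeroExtToNull n)
    (by
      refine TrivSqZeroExt.algHom_ext fun v => ?_
      simp only [trivSqZeroExtToNull, AlgHom.comp_apply, TrivSqZeroExt.lift_apply_inr,
        Fintype.linearCombination_apply, map_sum, map_smul, nullToTrivSqZeroExt_X,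
        AlgHom.id_apply, ← TrivSqZeroExt.inr_smul, ← Pi.single_smul, smul_eq_mul, mul_one]
      conv_rhs => rw [← Finset.univ_sum_single v]
      exact (map_sum (TrivSqZeroExt.inrHom ℂ (Fin n → ℂ)) _ _).symm)
    (by
      refine Ideal.Quotient.algHom_ext _ (MvPolynomial.algHom_ext fun i => ?_)
      simp [trivSqZeroExtToNull])

/-- The basis `1, x_1, …, x_n` of the null algebra, with `none` the index of `1`. -/
noncomputable def nullBasis : Module.Basis (Option (Fin n)) ℂ (NullAlgebra n) :=
  Module.Basis.ofEquivFun <| (nullAlgEquiv n).toLinearEquiv ≪≫ₗ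
    { toFun := fun a t => t.elim a.fst a.snd
      invFun := fun f => (f none, fun i => f (some i))
      map_add' := by intro a b; ext (_ | i) <;> rfl
      map_smul' := by intro a b; ext (_ | i) <;> rfl
      left_inv := fun _ => rfl
      right_inv := by intro f; ext (_ | i) <;> rfl }

theorem nullBasis_repr_none (a : NullAlgebra n) :
    (nullBasis n).repr a none = (nullAlgEquiv n a).fst := rfl

theorem nullBasis_repr_some (a : NullAlgebra n) (i : Fin n) :
    (nullBasis n).repr a (some i) = (nullAlgEquiv n a).snd i := rfl

end NullAlgebra

/-! ### The structure tensor in coordinates -/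

section Coordinates

/-- The structure tensor of the null algebra, as a polynomial in the coordinates. -/
def nullForm {R : Type*} [CommRing R] {n k : ℕ} (x : Option (Fin k) → Option (Fin n) → R) : R :=
  x none none * ∏ j, x (some j) none +
    ∑ j, (∑ i, x none (some i) * x (some j) (some i)) *
      ∏ l ∈ Finset.univ.erase j, x (some l) none

theorem map_nullForm {R S : Type*} [CommRing R] [CommRing S] (f : R →+* S) {n k : ℕ}
    (x : Option (Fin k) → Option (Fin n) → R) :
    f (nullForm x) = nullForm fun i t => f (x i t) := by
  simp [nullForm]

/-- The Leibniz rule: products of two elements of `M` vanish, so only terms with a single factor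
from `M` survive. -/
theorem snd_trivSqZeroExt_prod {R M ι : Type*} [CommRing R] [AddCommGroup M] [Module R M]
    [Module Rᵐᵒᵖ M] [IsCentralScalar R M] [DecidableEq ι] (s : Finset ι)
    (a : ι → TrivSqZeroExt R M) :
    (∏ j ∈ s, a j).snd = ∑ j ∈ s, (∏ l ∈ s.erase j, (a l).fst) • (a j).snd := by
  have hfst : ∀ s : Finset ι, (∏ j ∈ s, a j).fst = ∏ j ∈ s, (a j).fst := fun s =>
    map_prod (TrivSqZeroExt.fstHom R R M) a s
  induction s using Finset.induction_on with
  | empty => simp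
  | insert i s hi ih =>
    rw [Finset.prod_insert hi, TrivSqZeroExt.snd_mul, ih, hfst, Finset.sum_insert hi,
      Finset.erase_insert hi, op_smul_eq_smul, add_comm, Finset.smul_sum]
    congr 1
    refine Finset.sum_congr rfl fun j hj => ?_
    have hne : i ≠ j := fun h => hi (h ▸ hj)
    rw [Finset.erase_insert_of_ne hne, Finset.prod_insert (by simp [hi]), mul_smul]

theorem apply_prod_eq_nullForm {n k : ℕ} (α : Module.Dual ℂ (NullAlgebra n))
    (a : Fin k → NullAlgebra n) :
    α (List.ofFn a).prod = nullForm fun i t => match i with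
      | none => α (nullBasis n t)
      | some j => (nullBasis n).repr (a j) t := by
  classical
  conv_lhs => rw [← (nullBasis n).sum_repr (List.ofFn a).prod]
  rw [List.prod_ofFn, map_sum, Fintype.sum_option]
  simp only [map_smul, nullForm, nullBasis_repr_none, nullBasis_repr_some, map_prod,
    snd_trivSqZeroExt_prod, smul_eq_mul]
  have hfst : (∏ j, nullAlgEquiv n (a j)).fst = ∏ j, (nullAlgEquiv n (a j)).fst :=
    map_prod (TrivSqZeroExt.fstHom ℂ ℂ (Fin n → ℂ)) _ _
  rw [hfst, mul_comm]
  congr 1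
  simp only [Finset.sum_apply, Pi.smul_apply, Finset.sum_mul, smul_eq_mul]
  rw [Finset.sum_comm]
  refine Finset.sum_congr rfl fun j _ => Finset.sum_congr rfl fun i _ => ?_
  ring

/-- The bases of the factors of the structure tensor that come from a basis of the algebra. -/
noncomputable def factorBasis {A : Type*} [AddCommGroup A] [Module ℂ A] {σ : Type*} [Finite σ]
    [DecidableEq σ] (b : Module.Basis σ ℂ A) (k : ℕ) :
    ∀ i, Module.Basis σ ℂ (Factor A k i)
  | none => b
  | some _ => b.dualBasis

/-- By reflexivity A** = A, `structureTensor_apply` covers all families of functionals. -/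
theorem exists_factorDualMk_eq {A : Type*} [AddCommGroup A] [Module ℂ A] [Module.Finite ℂ A]
    {k : ℕ} (γ : ∀ i, Module.Dual ℂ (Factor A k i)) :
    ∃ (α : Module.Dual ℂ A) (a : Fin k → A), factorDualMk α a = γ := by
  refine ⟨γ none, fun j => (Module.evalEquiv ℂ A).symm (γ (some j)), funext ?_⟩
  rintro (_ | j)
  · rfl
  · exact (Module.evalEquiv ℂ A).apply_symm_apply (γ (some j))

theorem dualDistrib_structureTensor_null {n k : ℕ}
    (γ : ∀ i, Module.Dual ℂ (Factor (NullAlgebra n) k i)) :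
    PiTensorProduct.dualDistrib (⨂ₜ[ℂ] i, γ i) (structureTensor (NullAlgebra n) k) =
      nullForm fun i t => γ i (factorBasis (nullBasis n) k i t) := by
  obtain ⟨α, a, rfl⟩ := exists_factorDualMk_eq γ
  rw [structureTensor_apply, apply_prod_eq_nullForm]
  congr 1
  ext (_ | j) t
  · rfl
  · exact ((nullBasis n).dualBasis_apply t (a j)).symm

end Coordinates

/-- All the other summands contain the vanishing unit coordinate as a factor. -/
theorem nullForm_of_eq_zero {R : Type*} [CommRing R] {n k : ℕ}
    {x : Option (Fin k) → Option (Fin n) → R} {l : Fin k} (hl : x (some l) none = 0) :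
    nullForm x = (∑ i, x none (some i) * x (some l) (some i)) *
      ∏ m ∈ Finset.univ.erase l, x (some m) none := by
  rw [nullForm, Finset.prod_eq_zero (Finset.mem_univ l) hl, mul_zero, zero_add]
  refine Finset.sum_eq_single l (fun j _ hj => ?_) (by simp)
  rw [Finset.prod_eq_zero (Finset.mem_erase.mpr ⟨hj.symm, Finset.mem_univ l⟩) hl, mul_zero]

theorem nullForm_eq_zero_of_two {R : Type*} [CommRing R] {n k : ℕ}
    {x : Option (Fin k) → Option (Fin n) → R} {l m : Fin k} (hlm : l ≠ m)
    (hl : x (some l) none = 0) (hm : x (some m) none = 0) : nullForm x = 0 := by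
  rw [nullForm_of_eq_zero hl,
    Finset.prod_eq_zero (Finset.mem_erase.mpr ⟨hlm.symm, Finset.mem_univ m⟩) hm, mul_zero]

/-! ### Coefficients of tensors -/

section Coefficients

variable {ι : Type*} [Finite ι]

theorem dualDistrib_map {V W : ι → Type*}
    [∀ i, AddCommGroup (V i)] [∀ i, Module ℂ (V i)]
    [∀ i, AddCommGroup (W i)] [∀ i, Module ℂ (W i)]
    (X : ∀ i, V i →ₗ[ℂ] W i) (f : ∀ i, Module.Dual ℂ (W i)) (T : ⨂[ℂ] i, V i) :
    PiTensorProduct.dualDistrib (⨂ₜ[ℂ] i, f i) (PiTensorProduct.map X T) =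
      PiTensorProduct.dualDistrib (⨂ₜ[ℂ] i, (f i ∘ₗ X i : Module.Dual ℂ (V i))) T := by
  cases nonempty_fintype ι
  have h : (PiTensorProduct.dualDistrib (⨂ₜ[ℂ] i, f i)) ∘ₗ PiTensorProduct.map X =
      PiTensorProduct.dualDistrib (⨂ₜ[ℂ] i, (f i ∘ₗ X i : Module.Dual ℂ (V i))) := by
    ext v
    simp [PiTensorProduct.dualDistrib_apply]
  exact LinearMap.congr_fun h T

/-- The coefficients of a tensor in `ℂ^r ⊗ ⋯ ⊗ ℂ^r`. -/
noncomputable def coeff {r : ℕ} (s : ι → Fin r) : Module.Dual ℂ (⨂[ℂ] _ : ι, (Fin r → ℂ)) :=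
  PiTensorProduct.dualDistrib (⨂ₜ[ℂ] i, (LinearMap.proj (s i) : Module.Dual ℂ (Fin r → ℂ)))

theorem coeff_injective {r : ℕ} {S S' : ⨂[ℂ] _ : ι, (Fin r → ℂ)}
    (h : ∀ s, coeff s S = coeff s S') : S = S' := by
  cases nonempty_fintype ι
  let B := Basis.piTensorProduct fun _ : ι => Pi.basisFun ℂ (Fin r)
  have hB : ∀ s, B.coord s = coeff s := by
    intro s
    ext v
    simp [B, coeff, PiTensorProduct.dualDistrib_apply, Basis.piTensorProduct_repr_tprod_apply]
  refine B.ext_elem fun s => ?_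
  have := h s
  rwa [← hB] at this

theorem coeff_unitTensor {r : ℕ} [Fintype ι] (s : ι → Fin r) :
    coeff s (unitTensor ι r) = ∑ i, ∏ p, if s p = i then 1 else 0 := by
  simp [unitTensor, coeff, PiTensorProduct.dualDistrib_apply, Pi.single_apply]

end Coefficients

/-! ### Lower bounds for the subrank -/

theorem restricts_unitTensor_of_nullForm {n k r : ℕ}
    (M : Option (Fin k) → Option (Fin n) → Fin r → ℂ)
    (h : ∀ s : Option (Fin k) → Fin r,
      nullForm (fun i t => M i t (s i)) = ∑ i, ∏ p, if s p = i then 1 else 0) :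
    Restricts (structureTensor (NullAlgebra n) k) (unitTensor (Option (Fin k)) r) := by
  refine ⟨fun i => (factorBasis (nullBasis n) k i).constr ℂ (M i), coeff_injective fun s => ?_⟩
  rw [coeff, dualDistrib_map, dualDistrib_structureTensor_null, ← coeff, coeff_unitTensor, ← h]
  congr 1
  ext i t
  exact congrFun (Module.Basis.constr_basis _ ℂ (M i) t) (s i)

theorem restricts_unitTensor_one (n k : ℕ) :
    Restricts (structureTensor (NullAlgebra n) k) (unitTensor (Option (Fin k)) 1) := by
  refine restricts_unitTensor_of_nullForm (fun _ t _ => if t = none then 1 else 0) fun s => ?_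
  simp [nullForm, Subsingleton.elim _ (0 : Fin 1)]

theorem restricts_unitTensor_two {n : ℕ} (hn : 2 ≤ n) :
    Restricts (structureTensor (NullAlgebra n) 2) (unitTensor (Option (Fin 2)) 2) := by
  let p : Fin 2 → Fin n := Fin.castLE hn
  have hp : ∀ a b, p a = p b ↔ a = b := fun a b => (Fin.castLE_injective hn).eq_iff
  -- The factor `none` sends x_{p a} to e_a. Copy j of the dual sends the dual vector of 1 to e_j
  -- and, for a ≠ j, that of x_{p a} to e_a. The term of x_{p a} then becomes e_a ⊗ e_a ⊗ e_a.
  refine restricts_unitTensor_of_nullForm (fun i t a => match i, t with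
    | none, none => 0
    | none, some i => if i = p a then 1 else 0
    | some j, none => if a = j then 1 else 0
    | some j, some i => if a ≠ j ∧ i = p a then 1 else 0) fun s => ?_
  have he0 : (Finset.univ : Finset (Fin 2)).erase 0 = {1} := by decide
  have he1 : (Finset.univ : Finset (Fin 2)).erase 1 = {0} := by decide
  simp only [nullForm, Fin.sum_univ_two, Fintype.prod_option, Fin.prod_univ_two, he0, he1,
    Finset.prod_singleton, ite_mul, zero_mul, one_mul, Finset.sum_ite_eq', Finset.mem_univ,
    if_true, hp]
  generalize s none = a, s (some 0) = b, s (some 1) = c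
  fin_cases a <;> fin_cases b <;> fin_cases c <;> simp

/-! ### Upper bound for the border subrank -/

/-- Even for `v = 0` a unit vector is supplied; this keeps the vectors c_l in a compact set that
avoids 0. -/
theorem exists_norm_eq_one_smul {r : ℕ} (hr : 0 < r) (v : Fin r → ℂ) :
    ∃ (u : Fin r → ℂ) (a : ℂ), ‖u‖ = 1 ∧ v = a • u := by
  by_cases hv : v = 0
  · have : Nonempty (Fin r) := ⟨⟨0, hr⟩⟩
    exact ⟨fun _ => 1, 0, by simp [pi_norm_const], by simp [hv]⟩
  · refine ⟨(‖v‖⁻¹ : ℂ) • v, ‖v‖, ?_, ?_⟩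
    · rw [norm_smul, norm_inv, Complex.norm_real, norm_norm, inv_mul_cancel₀ (norm_ne_zero_iff.mpr hv)]
    · rw [smul_smul, mul_inv_cancel₀ (by simpa using hv), one_smul]

/-- The value of the array of coefficients `g` on the vectors `c_l(i) e_j - c_l(j) e_i` and
`c_m(i') e_j - c_m(j) e_{i'}` in the factors `l` and `m`, and on `e_j` in the other factors. -/
def kernelPairing {k r : ℕ} (c : Fin k → Fin r → ℂ) (g : (Option (Fin k) → Fin r) → ℂ)
    (l m : Fin k) (i i' j : Fin r) : ℂ :=
  c l i * c m i' * g (fun _ => j) -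
    c l i * c m j * g (Function.update (fun _ => j) (some m) i') -
    c l j * c m i' * g (Function.update (fun _ => j) (some l) i) +
    c l j * c m j * g (Function.update (Function.update (fun _ => j) (some l) i) (some m) i')

/-- Multilinear expansion in the slots `l` and `m`. The polynomial side gives continuity, the dual
side gives vanishing on restrictions. -/
theorem kernelPairing_eq_dualDistrib {k r : ℕ} (c : Fin k → Fin r → ℂ)
    (S : ⨂[ℂ] _ : Option (Fin k), (Fin r → ℂ)) {l m : Fin k} (hlm : l ≠ m) (i i' j : Fin r) :
    kernelPairing c (fun s => coeff s S) l m i i' j =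
      PiTensorProduct.dualDistrib (⨂ₜ[ℂ] p, Function.update (Function.update
        (fun _ => (LinearMap.proj j : Module.Dual ℂ (Fin r → ℂ)))
        (some l) (c l i • LinearMap.proj j - c l j • LinearMap.proj i))
        (some m) (c m i' • LinearMap.proj j - c m j • LinearMap.proj i') p) S := by
  have hne : (some l : Option (Fin k)) ≠ some m := by simpa using hlm
  have hco : ∀ s : Option (Fin k) → Fin r, coeff s S = PiTensorProduct.dualDistrib
      (PiTensorProduct.tprod ℂ fun p => (LinearMap.proj (s p) : Module.Dual ℂ (Fin r → ℂ))) S :=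
    fun _ => rfl
  have hup : ∀ (s : Option (Fin k) → Fin r) q t,
      (fun p => (LinearMap.proj (Function.update s q t p) : Module.Dual ℂ (Fin r → ℂ))) =
        Function.update (fun p => LinearMap.proj (s p)) q (LinearMap.proj t) := by
    intro s q t
    ext p : 1
    by_cases h : p = q
    · subst h; simp
    · simp [h]
  have hself : ∀ q, Function.update (fun _ : Option (Fin k) =>
      (LinearMap.proj j : Module.Dual ℂ (Fin r → ℂ))) q (LinearMap.proj j) =
        fun _ => LinearMap.proj j := fun q => Function.update_eq_self q _
  have hself' : Function.update (Function.update (fun _ : Option (Fin k) =>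
      (LinearMap.proj j : Module.Dual ℂ (Fin r → ℂ))) (some l) (LinearMap.proj i))
        (some m) (LinearMap.proj j) =
        Function.update (fun _ => LinearMap.proj j) (some l) (LinearMap.proj i) := by
    rw [Function.update_comm hne, hself]
  simp only [kernelPairing, hco, hup]
  simp only [MultilinearMap.map_update_sub, MultilinearMap.map_update_smul,
    Function.update_comm hne (_ - _), map_sub, map_smul, LinearMap.sub_apply, LinearMap.smul_apply,
    smul_eq_mul]
  simp only [Function.update_comm hne.symm, hself, hself', MultilinearMap.map_update_sub,
    MultilinearMap.map_update_smul, map_sub, map_smul, LinearMap.sub_apply, LinearMap.smul_apply,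
    smul_eq_mul]
  ring

/-- The functionals inserted at `l` and `m` kill `c l` and `c m`, so after pulling back along `X`
two unit coordinates vanish. -/
theorem exists_kernelPairing_eq_zero_of_restricts {n k r : ℕ} (hr : 0 < r)
    {S : ⨂[ℂ] _ : Option (Fin k), (Fin r → ℂ)}
    (h : Restricts (structureTensor (NullAlgebra n) k) S) :
    ∃ c : Fin k → Fin r → ℂ, (∀ l, ‖c l‖ = 1) ∧
      ∀ l m, l ≠ m → ∀ i i' j, kernelPairing c (fun s => coeff s S) l m i i' j = 0 := by
  obtain ⟨X, rfl⟩ := h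
  choose c a hc ha using fun l : Fin k => exists_norm_eq_one_smul hr
    (X (some l) (factorBasis (nullBasis n) k (some l) none))
  refine ⟨c, hc, fun l m hlm i i' j => ?_⟩
  have hne : (some l : Option (Fin k)) ≠ some m := by simpa using hlm
  rw [kernelPairing_eq_dualDistrib c _ hlm, dualDistrib_map, dualDistrib_structureTensor_null]
  refine nullForm_eq_zero_of_two hlm ?_ ?_
  · rw [Function.update_of_ne hne, Function.update_self, LinearMap.comp_apply, ha]
    simp [mul_comm]
  · rw [Function.update_self, LinearMap.comp_apply, ha]
    simp [mul_comm]

/-- Projection along the compact product of unit spheres is a closed map. -/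
theorem isClosed_exists_kernelPairing_eq_zero (k r : ℕ) :
    IsClosed {g : (Option (Fin k) → Fin r) → ℂ | ∃ c : Fin k → Fin r → ℂ, (∀ l, ‖c l‖ = 1) ∧
      ∀ l m, l ≠ m → ∀ i i' j, kernelPairing c g l m i i' j = 0} := by
  let K : Set (Fin k → Fin r → ℂ) := Set.univ.pi fun _ => Metric.sphere 0 1
  have hK : IsCompact K := isCompact_univ_pi fun _ => isCompact_sphere 0 1
  have : CompactSpace K := isCompact_iff_compactSpace.mp hK
  have hZ : IsClosed {z : K × ((Option (Fin k) → Fin r) → ℂ) |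
      ∀ l m, l ≠ m → ∀ i i' j, kernelPairing z.1 z.2 l m i i' j = 0} := by
    simp only [Set.ofPred_forall]
    refine isClosed_iInter fun l => isClosed_iInter fun m => isClosed_iInter fun _ =>
      isClosed_iInter fun i => isClosed_iInter fun i' => isClosed_iInter fun j =>
      isClosed_eq ?_ continuous_const
    have hc : ∀ l i, Continuous fun z : K × ((Option (Fin k) → Fin r) → ℂ) => z.1.1 l i :=
      fun l i => (continuous_apply_apply l i).comp (continuous_subtype_val.comp continuous_fst)
    have hg : ∀ s, Continuous fun z : K × ((Option (Fin k) → Fin r) → ℂ) => z.2 s :=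
      fun s => (continuous_apply s).comp continuous_snd
    exact (((((hc l i).mul (hc m i')).mul (hg _)).sub (((hc l i).mul (hc m j)).mul (hg _))).sub
      (((hc l j).mul (hc m i')).mul (hg _))).add (((hc l j).mul (hc m j)).mul (hg _))
  convert isClosedMap_snd_of_compactSpace _ hZ using 1
  ext g
  constructor
  · rintro ⟨c, hc, h⟩
    exact ⟨(⟨c, fun l _ => by simpa using hc l⟩, g), h, rfl⟩
  · rintro ⟨⟨⟨c, hc⟩, g⟩, h, rfl⟩
    exact ⟨c, fun l => by simpa using hc l (Set.mem_univ l), h⟩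

theorem exists_kernelPairing_eq_zero_of_degenerates {n k r : ℕ} (hr : 0 < r)
    {S : ⨂[ℂ] _ : Option (Fin k), (Fin r → ℂ)}
    (h : Degenerates (structureTensor (NullAlgebra n) k) S) :
    ∃ c : Fin k → Fin r → ℂ, (∀ l, ‖c l‖ = 1) ∧
      ∀ l m, l ≠ m → ∀ i i' j, kernelPairing c (fun s => coeff s S) l m i i' j = 0 := by
  let : TopologicalSpace (⨂[ℂ] _ : Option (Fin k), (Fin r → ℂ)) := moduleTopology ℂ _
  have : IsModuleTopology ℂ (⨂[ℂ] _ : Option (Fin k), (Fin r → ℂ)) := ⟨rfl⟩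
  have hcont : Continuous fun (S : ⨂[ℂ] _ : Option (Fin k), (Fin r → ℂ)) s => coeff s S :=
    continuous_pi fun s => IsModuleTopology.continuous_of_linearMap (coeff s)
  exact closure_minimal
    (fun S' hS' => exists_kernelPairing_eq_zero_of_restricts (n := n) hr hS')
    ((isClosed_exists_kernelPairing_eq_zero k r).preimage hcont) h

/-- The index at `none` stays `j`, so the three other terms sit off the diagonal, even when `i =
i'`. -/
theorem kernelPairing_unitTensor {k r : ℕ} (c : Fin k → Fin r → ℂ) {l m : Fin k}
    {i i' j : Fin r} (hi : i ≠ j) (hi' : i' ≠ j) :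
    kernelPairing c (fun s => coeff s (unitTensor (Option (Fin k)) r)) l m i i' j =
      c l i * c m i' := by
  have h0 : ∀ (s : Option (Fin k) → Fin r) (q : Option (Fin k)), s none = j → s q ≠ j →
      coeff s (unitTensor (Option (Fin k)) r) = 0 := by
    intro s q hs hq
    rw [coeff_unitTensor]
    refine Finset.sum_eq_zero fun t _ => ?_
    by_cases ht : t = j
    · exact Finset.prod_eq_zero (Finset.mem_univ q) (if_neg (by rwa [ht]))
    · exact Finset.prod_eq_zero (Finset.mem_univ none) (if_neg (by rw [hs]; exact Ne.symm ht))
  have h1 : coeff (fun _ => j) (unitTensor (Option (Fin k)) r) = 1 := by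
    rw [coeff_unitTensor, Finset.sum_eq_single j] <;> simp +contextual [eq_comm]
  simp only [kernelPairing]
  rw [h1, h0 _ (some m) (by simp) (by simpa using hi'), h0 _ (some l) (by simp) (by simpa using hi),
    h0 _ (some m) (by simp) (by simpa using hi')]
  ring

/-- If the structure tensor of a null algebra degenerates to the unit tensor of size `r`, then
there are `k` elements of `Fin r` any two of which exhaust `Fin r`. -/
theorem exists_pairwise_exhausting_of_degenerates {n k r : ℕ} (hr : 0 < r)
    (h : Degenerates (structureTensor (NullAlgebra n) k) (unitTensor (Option (Fin k)) r)) :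
    ∃ f : Fin k → Fin r, ∀ l m, l ≠ m → ∀ j, j = f l ∨ j = f m := by
  obtain ⟨c, hc, hz⟩ := exists_kernelPairing_eq_zero_of_degenerates hr h
  have hex : ∀ l, ∃ i, c l i ≠ 0 := by
    intro l
    by_contra! h0
    have : c l = 0 := funext h0
    simpa [this] using hc l
  -- Any support index of `c l` will do: a `j` missed by both `f l` and `f m` makes the pairing the
  -- nonzero product `c l (f l) * c m (f m)`.
  choose f hf using hex
  refine ⟨f, fun l m hlm j => ?_⟩
  by_contra! hj
  have := hz l m hlm (f l) (f m) j
  rw [kernelPairing_unitTensor c hj.1.symm hj.2.symm] at this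
  exact mul_ne_zero (hf l) (hf m) this

theorem le_two_of_degenerates {n k r : ℕ} (hk : 2 ≤ k)
    (h : Degenerates (structureTensor (NullAlgebra n) k) (unitTensor (Option (Fin k)) r)) :
    r ≤ 2 := by
  rcases Nat.eq_zero_or_pos r with rfl | hr
  · exact zero_le
  obtain ⟨f, hf⟩ := exists_pairwise_exhausting_of_degenerates hr h
  have hsub : (Finset.univ : Finset (Fin r)) ⊆ {f ⟨0, by lia⟩, f ⟨1, by lia⟩} := by
    intro j _
    simpa using hf ⟨0, by lia⟩ ⟨1, by lia⟩ (by simp) j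
  simpa using (Finset.card_le_card hsub).trans Finset.card_le_two

theorem le_one_of_degenerates {n k r : ℕ} (hk : 3 ≤ k)
    (h : Degenerates (structureTensor (NullAlgebra n) k) (unitTensor (Option (Fin k)) r)) :
    r ≤ 1 := by
  rcases Nat.eq_zero_or_pos r with rfl | hr
  · exact zero_le
  obtain ⟨f, hf⟩ := exists_pairwise_exhausting_of_degenerates hr h
  have h01 := hf ⟨0, by lia⟩ ⟨1, by lia⟩ (by simp)
  have h02 := hf ⟨0, by lia⟩ ⟨2, by lia⟩ (by simp)
  have h12 := hf ⟨1, by lia⟩ ⟨2, by lia⟩ (by simp)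
  by_contra! hr1
  have hj : ∀ a : Fin r, ∃ j, j ≠ a := fun a =>
    have : Nontrivial (Fin r) := Fin.nontrivial_iff_two_le.mpr hr1
    exists_ne a
  -- Such a `j` must equal both `f 1` and `f 2`, and then these two miss `f 0`.
  obtain ⟨j, hj0⟩ := hj (f ⟨0, by lia⟩)
  have e1 := (h01 j).resolve_left hj0
  have e2 := (h02 j).resolve_left hj0
  rcases h12 (f ⟨0, by lia⟩) with e | e
  · exact hj0 (e1.trans e.symm)
  · exact hj0 (e2.trans e.symm)

theorem Restricts.degenerates {ι : Type*} {V W : ι → Type*}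
    [∀ i, AddCommGroup (V i)] [∀ i, Module ℂ (V i)]
    [∀ i, AddCommGroup (W i)] [∀ i, Module ℂ (W i)]
    {T : ⨂[ℂ] i, V i} {S : ⨂[ℂ] i, W i} (h : Restricts T S) : Degenerates T S :=
  letI := moduleTopology ℂ (⨂[ℂ] i, W i)
  subset_closure h

theorem isSubrank_and_isBorderSubrank {ι : Type*} {V : ι → Type*}
    [∀ i, AddCommGroup (V i)] [∀ i, Module ℂ (V i)] {T : ⨂[ℂ] i, V i} {q : ℕ}
    (hq : Restricts T (unitTensor ι q)) (hle : ∀ r, Degenerates T (unitTensor ι r) → r ≤ q) :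
    IsSubrank T q ∧ IsBorderSubrank T q :=
  ⟨⟨hq, fun r hr => hle r hr.degenerates⟩, ⟨hq.degenerates, hle⟩⟩

/-! ### Heights of ideals of polynomials -/

section Height

open MvPolynomial

variable {σ : Type*}

/-- The chain 0 < (X a) < P is strict: the point `y` shows that `g` is not a multiple of `X a`. -/
theorem two_le_height_of_X_mem {P : Ideal (MvPolynomial σ ℂ)} [P.IsPrime] (a : σ)
    (ha : X a ∈ P) (g : MvPolynomial σ ℂ) (hg : g ∈ P) (y : σ → ℂ) (hy : y a = 0)
    (hgy : aeval y g ≠ 0) : 2 ≤ P.height := by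
  have h1 : (Ideal.span {(X a : MvPolynomial σ ℂ)}).IsPrime :=
    (Ideal.span_singleton_prime (X_ne_zero a)).mpr X_prime
  have hlt0 : (⊥ : Ideal (MvPolynomial σ ℂ)) < Ideal.span {X a} :=
    bot_lt_iff_ne_bot.mpr fun h => X_ne_zero a (Ideal.span_singleton_eq_bot.mp h)
  have hlt1 : Ideal.span {(X a : MvPolynomial σ ℂ)} < P := by
    refine lt_of_le_of_ne ((Ideal.span_singleton_le_iff_mem P).mpr ha) fun h => hgy ?_
    rw [← h, Ideal.mem_span_singleton] at hg
    obtain ⟨q, rfl⟩ := hg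
    simp [hy]
  calc (2 : ℕ∞) = 0 + 1 + 1 := by norm_num
    _ ≤ (⊥ : Ideal (MvPolynomial σ ℂ)).height + 1 + 1 := by gcongr; exact zero_le
    _ ≤ (Ideal.span {(X a : MvPolynomial σ ℂ)}).height + 1 := by
      gcongr; exact Ideal.height_add_one_le_of_lt_of_isPrime hlt0
    _ ≤ P.height := Ideal.height_add_one_le_of_lt_of_isPrime hlt1

/-- By the Nullstellensatz the vanishing ideal lies in the radical of (f, g). This ideal is proper
because of `h0`, and Krull's theorem bounds the height of a minimal prime over it. -/
theorem height_vanishingIdeal_le_two [Finite σ] {Z : Set (σ → ℂ)} (f g : MvPolynomial σ ℂ)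
    (h0 : ∃ y : σ → ℂ, aeval y f = 0 ∧ aeval y g = 0)
    (hZ : ∀ y : σ → ℂ, aeval y f = 0 → aeval y g = 0 → y ∈ Z) :
    (vanishingIdeal ℂ Z).height ≤ 2 := by
  have hle : vanishingIdeal ℂ Z ≤ (Ideal.span {f, g}).radical := by
    rw [← vanishingIdeal_zeroLocus_eq_radical (K := ℂ)]
    refine vanishingIdeal_anti_mono fun y hy => hZ y ?_ ?_
    · exact hy _ (Ideal.subset_span (by simp))
    · exact hy _ (Ideal.subset_span (by simp))
  have htop : Ideal.span {f, g} ≠ ⊤ := by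
    obtain ⟨y, hf, hg⟩ := h0
    have hker : Ideal.span {f, g} ≤ RingHom.ker (aeval y : MvPolynomial σ ℂ →ₐ[ℂ] ℂ) := by
      rw [Ideal.span_le]
      rintro p (rfl | rfl)
      · exact hf
      · exact hg
    exact fun h => RingHom.ker_ne_top _ (top_le_iff.mp (h ▸ hker))
  classical
  obtain ⟨P, hP⟩ := Ideal.nonempty_minimalPrimes htop
  have := hP.1.1
  calc (vanishingIdeal ℂ Z).height ≤ P.height :=
        Ideal.height_mono (hle.trans (Ideal.IsPrime.radical_le_iff this |>.mpr hP.1.2))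
    _ ≤ ({f, g} : Finset (MvPolynomial σ ℂ)).card :=
      Ideal.height_le_card_of_mem_minimalPrimes_span_finset (by simpa using hP)
    _ ≤ 2 := by exact_mod_cast Finset.card_le_two

end Height

/-! ### The kernel variety in coordinates -/

section KernelVariety

variable {n k : ℕ} {i₀ : Option (Fin k)}

/-- The array with rows `y i` for `i ≠ i₀` and with row `w` at the index `i₀`. -/
def extendRow {R : Type*} (y : (Σ _ : {i : Option (Fin k) // i ≠ i₀}, Option (Fin n)) → R)
    (w : Option (Fin n) → R) (i : Option (Fin k)) (t : Option (Fin n)) : R :=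
  if h : i ≠ i₀ then y ⟨⟨i, h⟩, t⟩ else w t

theorem extendRow_of_ne {R : Type*}
    (y : (Σ _ : {i : Option (Fin k) // i ≠ i₀}, Option (Fin n)) → R)
    (w : Option (Fin n) → R) {i : Option (Fin k)} (h : i ≠ i₀) (t : Option (Fin n)) :
    extendRow y w i t = y ⟨⟨i, h⟩, t⟩ := dif_pos h

@[simp]
theorem extendRow_self {R : Type*}
    (y : (Σ _ : {i : Option (Fin k) // i ≠ i₀}, Option (Fin n)) → R)
    (w : Option (Fin n) → R) (t : Option (Fin n)) :
    extendRow y w i₀ t = w t := dif_neg (not_not.mpr rfl)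

variable (n i₀) in
/-- The coordinates on the tuples of linear forms on the factors with index other than `i₀`. -/
noncomputable def kernelBasis :
    Module.Basis (Σ _ : {i : Option (Fin k) // i ≠ i₀}, Option (Fin n)) ℂ
      (∀ i : {i : Option (Fin k) // i ≠ i₀}, Module.Dual ℂ (Factor (NullAlgebra n) k i)) :=
  Pi.basis fun i => (factorBasis (nullBasis n) k i).dualBasis

theorem kernelBasis_equivFun
    (α : ∀ i : {i : Option (Fin k) // i ≠ i₀}, Module.Dual ℂ (Factor (NullAlgebra n) k i))
    (i : {i : Option (Fin k) // i ≠ i₀}) (t : Option (Fin n)) :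
    (kernelBasis n i₀).equivFun α ⟨i, t⟩ = α i (factorBasis (nullBasis n) k i t) := by
  simp [kernelBasis, Module.Basis.equivFun_apply, Pi.basis_repr]

/-- The functional on the factor `i₀` is arbitrary, and its coordinates are the free row `w`. -/
theorem mem_image_kernelVariety_iff
    (y : (Σ _ : {i : Option (Fin k) // i ≠ i₀}, Option (Fin n)) → ℂ) :
    y ∈ (kernelBasis n i₀).equivFun '' kernelVariety (structureTensor (NullAlgebra n) k) i₀ ↔
      ∀ w, nullForm (extendRow y w) = 0 := by
  constructor
  · rintro ⟨α, hα, rfl⟩ w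
    have h := hα (fun i => if h : i ≠ i₀ then α ⟨i, h⟩ else
      (factorBasis (nullBasis n) k i).constr ℂ w) fun i => dif_pos i.2
    rw [dualDistrib_structureTensor_null] at h
    rw [← h]
    congr 1
    ext i t
    by_cases hi : i = i₀
    · subst hi
      simp
    · rw [extendRow_of_ne _ _ hi, kernelBasis_equivFun, dif_pos hi]
  · intro h
    obtain ⟨α, rfl⟩ := (kernelBasis n i₀).equivFun.surjective y
    refine ⟨α, fun γ hγ => ?_, rfl⟩
    rw [dualDistrib_structureTensor_null,
      ← h fun t => γ i₀ (factorBasis (nullBasis n) k i₀ t)]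
    congr 1
    ext i t
    by_cases hi : i = i₀
    · subst hi
      simp
    · rw [extendRow_of_ne _ _ hi, kernelBasis_equivFun, hγ ⟨i, hi⟩]

open MvPolynomial in
/-- The universal array with row `w` at the index `i₀`. -/
noncomputable def universalArray (n : ℕ) (i₀ : Option (Fin k)) (w : Option (Fin n) → ℂ) :
    Option (Fin k) → Option (Fin n) →
      MvPolynomial (Σ _ : {i : Option (Fin k) // i ≠ i₀}, Option (Fin n)) ℂ :=
  extendRow X fun t => C (w t)

theorem nullForm_universalArray_mem (w : Option (Fin n) → ℂ) :
    nullForm (universalArray n i₀ w) ∈ MvPolynomial.vanishingIdeal ℂ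
      ((kernelBasis n i₀).equivFun ''
        kernelVariety (structureTensor (NullAlgebra n) k) i₀) := by
  intro y hy
  rw [mem_image_kernelVariety_iff] at hy
  refine Eq.trans ?_ (hy w)
  refine (map_nullForm (R := MvPolynomial _ ℂ) (S := ℂ)
    (RingHomClass.toRingHom (MvPolynomial.aeval (R := ℂ) y)) _).trans ?_
  congr 1
  ext i t
  by_cases hi : i = i₀
  · subst hi
    simp [universalArray]
  · simp [universalArray, extendRow_of_ne _ _ hi]

end KernelVariety

/-! ### The geometric rank -/

section GeometricRank

open MvPolynomial

variable {n k : ℕ}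

theorem two_le_height_of_X_mem_of_X_mem {σ : Type*} {P : Ideal (MvPolynomial σ ℂ)}
    [P.IsPrime] {a b : σ} (hab : a ≠ b) (ha : X a ∈ P) (hb : X b ∈ P) : 2 ≤ P.height := by
  classical
  exact two_le_height_of_X_mem a ha (X b) hb (Pi.single b 1) (Pi.single_eq_of_ne hab 1) (by simp)

/-- For prime `P` the quotient is a domain, so the equations obtained from unit vectors `w` can be
split into factors. -/
theorem nullForm_quotient_eq_zero {i₀ : Option (Fin k)}
    {P : Ideal (MvPolynomial (Σ _ : {i : Option (Fin k) // i ≠ i₀}, Option (Fin n)) ℂ)}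
    (hP : vanishingIdeal ℂ ((kernelBasis n i₀).equivFun ''
        kernelVariety (structureTensor (NullAlgebra n) k) i₀) ≤ P) (w : Option (Fin n) → ℂ) :
    nullForm (fun i t => Ideal.Quotient.mk P (universalArray n i₀ w i t)) = 0 := by
  rw [← map_nullForm, Ideal.Quotient.eq_zero_iff_mem]
  exact hP (nullForm_universalArray_mem w)

theorem two_le_height_none (hn : 1 ≤ n)
    {P : Ideal (MvPolynomial (Σ _ : {i : Option (Fin k) // i ≠ none}, Option (Fin n)) ℂ)}
    [P.IsPrime] (hP : vanishingIdeal ℂ ((kernelBasis n none).equivFun ''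
        kernelVariety (structureTensor (NullAlgebra n) k) none) ≤ P) : 2 ≤ P.height := by
  have hsome : ∀ w (j : Fin k) t, universalArray n none w (some j) t =
      X ⟨⟨some j, Option.some_ne_none j⟩, t⟩ := fun w j t => extendRow_of_ne _ _ _ t
  have hnone : ∀ w t, universalArray n (none : Option (Fin k)) w none t = C (w t) :=
    fun w t => extendRow_self _ _ t
  -- This `w` leaves the product of all unit coordinates, so one of them, the `l`-th, lies in `P`.
  have h0 := nullForm_quotient_eq_zero hP (Pi.single none 1)
  simp only [nullForm, hsome, hnone] at h0
  simp only [Pi.single_eq_same, map_one, one_mul, ne_eq, reduceCtorEq, not_false_eq_true,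
    Pi.single_eq_of_ne, map_zero, zero_mul, Finset.sum_const_zero, add_zero,
    Finset.prod_eq_zero_iff, Finset.mem_univ, true_and] at h0
  obtain ⟨l, hl⟩ := h0
  -- Now only the `l`-th summand remains; one of its factors is a second variable in `P`.
  have h1 := nullForm_quotient_eq_zero hP (Pi.single (some ⟨0, hn⟩) 1)
  rw [nullForm_of_eq_zero (l := l) (by rwa [hsome])] at h1
  simp only [hsome, hnone] at h1
  rw [Finset.sum_eq_single ⟨0, hn⟩ (fun b _ hb => by simp [hb]) (by simp)] at h1
  simp only [Pi.single_eq_same, map_one, one_mul, mul_eq_zero, Finset.prod_eq_zero_iff,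
    Finset.mem_erase, Finset.mem_univ, and_true, Ideal.Quotient.eq_zero_iff_mem] at h1 hl
  rcases h1 with h1 | ⟨m, hm, h1⟩
  · exact two_le_height_of_X_mem_of_X_mem (by simp) hl h1
  · exact two_le_height_of_X_mem_of_X_mem (by simpa using hm.symm) hl h1

theorem two_le_height_some (hn : 1 ≤ n) (p : Fin k)
    {P : Ideal (MvPolynomial (Σ _ : {i : Option (Fin k) // i ≠ some p}, Option (Fin n)) ℂ)}
    [P.IsPrime] (hP : vanishingIdeal ℂ ((kernelBasis n (some p)).equivFun ''
        kernelVariety (structureTensor (NullAlgebra n) k) (some p)) ≤ P) : 2 ≤ P.height := by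
  have hnone : ∀ w t, universalArray n (some p) w none t =
      X ⟨⟨none, (Option.some_ne_none p).symm⟩, t⟩ := fun w t => extendRow_of_ne _ _ _ t
  have hne : ∀ {j : Fin k}, j ≠ p → (some j : Option (Fin k)) ≠ some p := fun h => by simpa using h
  have hsome : ∀ w (j : Fin k) (hj : j ≠ p) t, universalArray n (some p) w (some j) t =
      X ⟨⟨some j, hne hj⟩, t⟩ := fun w j _ t => extendRow_of_ne _ _ _ t
  have hself : ∀ w t, universalArray n (some p) w (some p) t = C (w t) :=
    fun w t => extendRow_self _ _ t
  have h0 := nullForm_quotient_eq_zero hP (Pi.single none 1)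
  -- If a unit coordinate outside `p` is in `P`, the equation `h0` factors and supplies the second
  -- element. Otherwise those coordinates can be cancelled, which puts the whole row `none` in `P`.
  by_cases hc : ∃ l, l ≠ p ∧
      Ideal.Quotient.mk P (universalArray n (some p) (Pi.single none 1) (some l) none) = 0
  · obtain ⟨l, hlp, hl⟩ := hc
    rw [nullForm_of_eq_zero hl, mul_eq_zero, Finset.prod_eq_zero_iff] at h0
    rw [hsome _ _ hlp, Ideal.Quotient.eq_zero_iff_mem] at hl
    rcases h0 with h0 | ⟨m, hm, h0⟩
    · simp only [hnone, hsome _ _ hlp, ← map_mul, ← map_sum, Ideal.Quotient.eq_zero_iff_mem] at h0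
      classical
      -- At this point the quadratic form takes the value `n`, which is nonzero.
      refine two_le_height_of_X_mem _ hl _ h0 (fun q => if q.2 = none then 0 else 1) (by simp) ?_
      simp
      lia
    · have hml := (Finset.mem_erase.mp hm).1
      by_cases hmp : m = p
      · subst hmp
        simp [hself] at h0
      · rw [hsome _ _ hmp, Ideal.Quotient.eq_zero_iff_mem] at h0
        exact two_le_height_of_X_mem_of_X_mem (by simpa using hml.symm) hl h0
  · push Not at hc
    have hprod : ∏ l ∈ Finset.univ.erase p, Ideal.Quotient.mk P
        (universalArray n (some p) (Pi.single none 1) (some l) none) ≠ 0 :=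
      Finset.prod_ne_zero_iff.mpr fun l hl => hc l (Finset.mem_erase.mp hl).1
    have hx : ∀ i : Fin n, X ⟨⟨none, (Option.some_ne_none p).symm⟩, some i⟩ ∈ P := by
      intro i
      have h1 := nullForm_quotient_eq_zero hP (Pi.single (some i) 1)
      rw [nullForm_of_eq_zero (l := p) (by simp [hself]), mul_eq_zero] at h1
      have hprod' : ∏ l ∈ Finset.univ.erase p, Ideal.Quotient.mk P
          (universalArray n (some p) (Pi.single (some i) 1) (some l) none) ≠ 0 := by
        rw [Finset.prod_congr rfl fun l hl => ?_]
        · exact hprod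
        · rw [hsome _ _ (Finset.mem_erase.mp hl).1, hsome _ _ (Finset.mem_erase.mp hl).1]
      have h2 := h1.resolve_right hprod'
      rw [Finset.sum_eq_single i (fun b _ hb => by simp [hself, hb]) (by simp)] at h2
      simpa [hself, hnone, Ideal.Quotient.eq_zero_iff_mem] using h2
    have hx0 : X ⟨⟨none, (Option.some_ne_none p).symm⟩, none⟩ ∈ P := by
      simp only [nullForm, hnone, fun i => Ideal.Quotient.eq_zero_iff_mem.mpr (hx i), zero_mul,
        Finset.sum_const_zero, add_zero] at h0
      rw [← Finset.mul_prod_erase _ _ (Finset.mem_univ p), hself, Pi.single_eq_same, map_one,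
        map_one, one_mul, mul_eq_zero] at h0
      exact Ideal.Quotient.eq_zero_iff_mem.mp (h0.resolve_right hprod)
    exact two_le_height_of_X_mem_of_X_mem (by simp) hx0 (hx ⟨0, hn⟩)

theorem height_le_two_none (hk : 2 ≤ k) :
    (vanishingIdeal ℂ ((kernelBasis n none).equivFun ''
        kernelVariety (structureTensor (NullAlgebra n) k) none)).height ≤ 2 := by
  refine height_vanishingIdeal_le_two
    (X ⟨⟨some ⟨0, by lia⟩, Option.some_ne_none _⟩, none⟩)
    (X ⟨⟨some ⟨1, by lia⟩, Option.some_ne_none _⟩, none⟩) ⟨0, by simp⟩ fun y h0 h1 => ?_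
  rw [mem_image_kernelVariety_iff]
  intro w
  rw [aeval_X] at h0 h1
  refine nullForm_eq_zero_of_two (l := ⟨0, by lia⟩) (m := ⟨1, by lia⟩) (by simp) ?_ ?_
  · rwa [extendRow_of_ne _ _ (Option.some_ne_none _)]
  · rwa [extendRow_of_ne _ _ (Option.some_ne_none _)]

/-- For `k = 2` only one unit coordinate is available besides that of `p`, so the second equation is
the quadratic factor left by `nullForm_of_eq_zero`. -/
theorem height_le_two_some (hk : 2 ≤ k) (p : Fin k) :
    (vanishingIdeal ℂ ((kernelBasis n (some p)).equivFun ''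
        kernelVariety (structureTensor (NullAlgebra n) k) (some p))).height ≤ 2 := by
  have : Nontrivial (Fin k) := Fin.nontrivial_iff_two_le.mpr hk
  obtain ⟨l, hl⟩ := exists_ne p
  have hl' : (some l : Option (Fin k)) ≠ some p := by simpa using hl
  refine height_vanishingIdeal_le_two (X ⟨⟨some l, hl'⟩, none⟩)
    (∑ i, X ⟨⟨none, (Option.some_ne_none p).symm⟩, some i⟩ * X ⟨⟨some l, hl'⟩, some i⟩)
    ⟨0, by simp⟩ fun y h0 h1 => ?_
  rw [mem_image_kernelVariety_iff]
  intro w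
  rw [aeval_X] at h0
  rw [nullForm_of_eq_zero (l := l) (by rwa [extendRow_of_ne _ _ hl'])]
  simp only [map_sum, map_mul, aeval_X] at h1
  simp only [extendRow_of_ne _ _ hl', extendRow_of_ne _ _ (Option.some_ne_none p).symm, h1,
    zero_mul]

theorem geometricRank_null (hn : 1 ≤ n) (hk : 2 ≤ k) (i₀ : Option (Fin k)) :
    geometricRank (structureTensor (NullAlgebra n) k) i₀ = 2 := by
  rw [geometricRank, codim_eq (kernelBasis n i₀)]
  apply le_antisymm
  · cases i₀ with
    | none => exact height_le_two_none hk
    | some p => exact height_le_two_some hk p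
  · rw [Ideal.height_eq_inf_minimalPrimes]
    refine le_iInf₂ fun P hP => ?_
    have := hP.1.1
    cases i₀ with
    | none => exact two_le_height_none hn hP.1.2
    | some p => exact two_le_height_some hn p hP.1.2

end GeometricRank

end TensorRank

theorem mainTheorem7 (n k : ℕ) :
    (1 ≤ n → 2 ≤ k → ∀ i₀ : Option (Fin k),
      TensorRank.geometricRank
        (TensorRank.structureTensor (TensorRank.NullAlgebra n) k) i₀ = 2) ∧
    (k = 2 → 2 ≤ n →
      TensorRank.IsSubrank (TensorRank.structureTensor (TensorRank.NullAlgebra n) k) 2 ∧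
      TensorRank.IsBorderSubrank (TensorRank.structureTensor (TensorRank.NullAlgebra n) k) 2) ∧
    (3 ≤ k →
      TensorRank.IsSubrank (TensorRank.structureTensor (TensorRank.NullAlgebra n) k) 1 ∧
      TensorRank.IsBorderSubrank (TensorRank.structureTensor (TensorRank.NullAlgebra n) k) 1) := by
  refine ⟨fun hn hk i₀ => TensorRank.geometricRank_null hn hk i₀, ?_, fun hk => ?_⟩
  · rintro rfl hn
    exact TensorRank.isSubrank_and_isBorderSubrank (TensorRank.restricts_unitTensor_two hn)
      fun r hr => TensorRank.le_two_of_degenerates le_rfl hr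
  · exact TensorRank.isSubrank_and_isBorderSubrank (TensorRank.restricts_unitTensor_one n k)
      fun r hr => TensorRank.le_one_of_degenerates hk hr
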